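/- Let $-\infty<a<b\le+\infty$ and $\mathcal M[y]=\frac1w\left(-(py')'+qy\right)$ on $[a,b)$, where $w>0$ and $p\ne0$ a.e., $p,q$ are complex-valued, $w,1/p,q\in L^1_{loc}[a,b)$, $Q=\overline{\mathrm{co}}\{q(x)/w(x)+rp(x): x\in[a,b),\,0<r<\infty\}\neq\mathbb C$, and $b$ is singular, i.e. $b=+\infty$ or $\int_a^b(w+1/|p|+|q|)\,dx=\infty$. Solutions of $\mathcal M[y]=\lambda y$ are functions $y$ with $y,py'$ locally absolutely continuous on $[a,b)$ which satisfy the equation a.e.; write $[u,v]=p(uv'-u'v)$ and $[u,v](b)=\lim_{x\to b}[u,v](x)$. Call $(\eta,K)\in\mathbb R\times\mathbb C$ admissible if $K$ is the nearest point of $Q$ to some $\lambda_0\in\mathbb C\setminus Q$, $\Re[(rp(x)+q(x)/w(x)-K)e^{i\eta}]\ge0$ for all $x\in[a,b)$, $0<r<\infty$, and $\Re[(\lambda_0-K)e^{i\eta}]<0$; put $\Lambda_{\eta,K}=\{\lambda\in\mathbb C:\Re[(\lambda-K)e^{i\eta}]\le0\}$. Let $\alpha\in\mathbb C$ and let $(\eta,K)$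 be admissible with $\Re[e^{i\eta}\cos\alpha\,\overline{\sin\alpha}]\le0$. Assume that the equation is in Sims Case II or III, i.e. that for some $\lambda\in\Lambda_{\eta,K}$ all solutions of $\mathcal M[y]=\lambda y$ lie in $L^2_w[a,b)$ and that either (Case II) up to constant multiples exactly one nontrivial solution, or (Case III) every solution, satisfies $$\int_a^b\Re\left[e^{i\eta}\{p|y'|^2+(q-Kw)|y|^2\}\right]dx+\int_a^b|y|^2w\,dx<\infty .$$ Let $\theta(\cdot,\lambda),\phi(\cdot,\lambda)$ be the solutions of $\mathcal M[y]=\lambda y$ with $\theta(a)=\cos\alpha$, $p\theta'(a)=\sin\alpha$, $\phi(a)=\sin\alpha$, $p\phi'(a)=-\cos\alpha$. Fix $\lambda'\in\Lambda_{\eta,K}$ and $m'\in\mathbb C$, and put $\psi=\theta(\cdot,\lambda')+m'\phi(\cdot,\lambda')$. Let $M$ be the realization of $\mathcal M$ in $L^2_w[a,b)$ with boundary conditions $y(a)\cos\alpha+py'(a)\sin\alpha=0$ and $[y,\psi](b)=0$, and let $L$ be the realization with boundary conditions $y(a)\sin\alpha-py'(a)\cos\alpha=0$ and $[y,\psi](b)=0$.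 Let $m(\lambda)$ be the number $m$ for which $\theta(\cdot,\lambda)+m\,\phi(\cdot,\lambda)$ lies in $L^2_w[a,b)$ and satisfies the boundary condition at $b$. Let $\ell(\lambda)$ be the number $\ell$ for which $\tilde\theta(\cdot,\lambda)+\ell\,\tilde\phi(\cdot,\lambda)$ does so, where $\tilde\theta,\tilde\phi$ are the solutions with $\tilde\theta(a)=\sin\alpha$, $p\tilde\theta'(a)=-\cos\alpha$, $\tilde\phi(a)=-\cos\alpha$, $p\tilde\phi'(a)=-\sin\alpha$. Let $a<b_n<b$, $b_n\nearrow b$, and let $m_n(\lambda)$, $\ell_n(\lambda)$ be the numbers for which $\theta(\cdot,\lambda)+m_n(\lambda)\phi(\cdot,\lambda)$, respectively $\tilde\theta(\cdot,\lambda)+\ell_n(\lambda)\tilde\phi(\cdot,\lambda)$, satisfies the truncated boundary condition $[y,\psi](b_n)=0$. Then: (i) $\lambda'$ is not an eigenvalue of $M$, and $m(\lambda')=m'$. (ii) Whenever $\beta_n,\kappa\in\mathbb C$ satisfy $(\cos\beta_n,\sin\beta_n)=\kappa\,(p\psi'(b_n),-\psi(b_n))$, the boundary condition $y(b_n)\cos\beta_n+py'(b_n)\sin\beta_n=0$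 is equivalent to $[y,\psi](b_n)=0$. (iii) For every $\lambda\in\mathbb C$ that is not an eigenvalue of $M$, $m(\lambda)$ exists and is unique, $m_n(\lambda)$ exists and is unique for all sufficiently large $n$, and $m_n(\lambda)\to m(\lambda)$ as $n\to\infty$. (iv) For every $\lambda\in\mathbb C$ that is not an eigenvalue of $L$, $\ell(\lambda)$ exists and is unique, $\ell_n(\lambda)$ exists and is unique for all sufficiently large $n$, and $\ell_n(\lambda)\to\ell(\lambda)$ as $n\to\infty$. -/

import Mathlib

open Filter Topology MeasureTheory Set

noncomputable section

/-- The data of a Sturm-Liouville expression `𝓜[y] = (1/w) (-(p y')' + q y)` on `[a, b)`,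
where `b` may be `+∞`. -/
structure SturmLiouville where
  a : ℝ
  b : EReal
  p : ℝ → ℂ
  q : ℝ → ℂ
  w : ℝ → ℝ

namespace SturmLiouville

variable (E : SturmLiouville)

/-- The half-open interval `[a, b)`. -/
def I : Set ℝ := {x | E.a ≤ x ∧ (x : EReal) < E.b}

/-- The filter `x → b` from the left (it is `atTop` if `b = +∞`). -/
def toEnd : Filter ℝ := comap (fun x : ℝ => (x : EReal)) (𝓝[<] E.b)

/-- `Q`, the closed convex hull of the values `q(x)/w(x) + r p(x)`, `x ∈ [a, b)`, `0 < r < ∞`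
(at the points where the quotient makes sense; `w > 0` almost everywhere). -/
def Q : Set ℂ :=
  closure (convexHull ℝ
    {z | ∃ x ∈ E.I, 0 < E.w x ∧ ∃ r : ℝ, 0 < r ∧ z = E.q x / (E.w x : ℂ) + (r : ℂ) * E.p x})

/-- The standing assumptions on the coefficients: `a < b`, `w > 0` and `p ≠ 0` a.e.,
`w, 1/p, q ∈ L¹_loc[a, b)`, `Q ≠ ℂ`, and `b` is a singular endpoint. -/
structure IsStandard : Prop where
  a_lt_b : (E.a : EReal) < E.b
  w_pos : ∀ᵐ x ∂volume.restrict E.I, 0 < E.w x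
  p_ne_zero : ∀ᵐ x ∂volume.restrict E.I, E.p x ≠ 0
  w_loc : LocallyIntegrableOn E.w E.I
  p_inv_loc : LocallyIntegrableOn (fun x => (E.p x)⁻¹) E.I
  q_loc : LocallyIntegrableOn E.q E.I
  Q_ne_univ : E.Q ≠ univ
  singular : E.b = ⊤ ∨ ¬ IntegrableOn (fun x => E.w x + ‖E.p x‖⁻¹ + ‖E.q x‖) E.I

/-- The set `S` of admissible pairs `(η, K)`: `K` is the nearest point of `Q` to some `z₀ ∉ Q`,
and after translating `K` to `0` and rotating by `η`, `Q` lies in the closed right half plane and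
`z₀` in the open left half plane. -/
def S : Set (ℝ × ℂ) :=
  {s | ∃ z₀ : ℂ, z₀ ∉ E.Q ∧ s.2 ∈ E.Q ∧ dist z₀ s.2 = Metric.infDist z₀ E.Q ∧
    (∀ x ∈ E.I, 0 < E.w x → ∀ r : ℝ, 0 < r →
      0 ≤ (((r : ℂ) * E.p x + E.q x / (E.w x : ℂ) - s.2) *
        Complex.exp (Complex.I * s.1)).re) ∧
    ((z₀ - s.2) * Complex.exp (Complex.I * s.1)).re < 0}

/-- The subset `S(α)` of those `(η, K) ∈ S` with `Re [e^{iη} cos α conj(sin α)] ≤ 0`. -/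
def SOf (α : ℂ) : Set (ℝ × ℂ) :=
  {s | s ∈ E.S ∧
    (Complex.exp (Complex.I * s.1) * Complex.cos α *
      (starRingEnd ℂ) (Complex.sin α)).re ≤ 0}

/-- The half plane `Λ_{η,K}`. -/
def Lam (η : ℝ) (K : ℂ) : Set ℂ := {z | ((z - K) * Complex.exp (Complex.I * η)).re ≤ 0}

/-- For a pair `Y = (y, u)`: `y` and `u` are locally absolutely continuous on `[a, b)`,
`u` is the quasi-derivative `p y'`, and `𝓜[y] = f`, i.e. `-(p y')' + q y = w f` a.e. -/
structure IsImage (Y : (ℝ → ℂ) × (ℝ → ℂ)) (f : ℝ → ℂ) : Prop where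
  ac_fst : ∀ x ∈ E.I, AbsolutelyContinuousOnInterval Y.1 E.a x
  ac_snd : ∀ x ∈ E.I, AbsolutelyContinuousOnInterval Y.2 E.a x
  deriv_fst : ∀ᵐ x ∂volume.restrict E.I, HasDerivAt Y.1 (Y.2 x / E.p x) x
  deriv_snd : ∀ᵐ x ∂volume.restrict E.I,
    HasDerivAt Y.2 (E.q x * Y.1 x - (E.w x : ℂ) * f x) x

/-- `Y = (y, p y')` solves `𝓜[y] = z y` on `[a, b)`. -/
def IsSolution (z : ℂ) (Y : (ℝ → ℂ) × (ℝ → ℂ)) : Prop :=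
  E.IsImage Y (fun x => z * Y.1 x)

/-- `f ∈ L²_w[a, b)`. -/
def MemL2w (f : ℝ → ℂ) : Prop :=
  MemLp f 2 ((volume.restrict E.I).withDensity (fun x => ENNReal.ofReal (E.w x)))

/-- The condition
`∫_a^b Re [e^{iη} (p |y'|² + (q - K w) |y|²)] dx + ∫_a^b |y|² w dx < ∞`
for `Y = (y, p y')`; for admissible `(η, K)` the first integrand is nonnegative. -/
def SimsFinite (η : ℝ) (K : ℂ) (Y : (ℝ → ℂ) × (ℝ → ℂ)) : Prop :=
  IntegrableOn (fun x => (Complex.exp (Complex.I * η) *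
      (E.p x * ((‖Y.2 x / E.p x‖ ^ 2 : ℝ) : ℂ) +
        (E.q x - K * (E.w x : ℂ)) * ((‖Y.1 x‖ ^ 2 : ℝ) : ℂ))).re) E.I ∧
  E.MemL2w Y.1

/-- Sims Case II with respect to `(η, K)`: all solutions lie in `L²_w[a, b)`, and up to constant
multiples there is exactly one nontrivial solution with the property `SimsFinite`. The
classification does not depend on the spectral parameter `z ∈ Λ_{η,K}`, so that it is enough to
ask this for one such `z`. -/
def SimsCaseII (η : ℝ) (K : ℂ) : Prop :=
  ∃ z ∈ Lam η K,
    (∀ Y, E.IsSolution z Y → E.MemL2w Y.1) ∧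
    ∃ Y₀, E.IsSolution z Y₀ ∧ (∃ x ∈ E.I, Y₀.1 x ≠ 0) ∧ E.SimsFinite η K Y₀ ∧
      ∀ Y, E.IsSolution z Y → E.SimsFinite η K Y → ∃ k : ℂ, ∀ x ∈ E.I, Y.1 x = k * Y₀.1 x

/-- Sims Case III with respect to `(η, K)`: all solutions lie in `L²_w[a, b)` and have the property
`SimsFinite` (for one, equivalently for all, `z ∈ Λ_{η,K}`). -/
def SimsCaseIII (η : ℝ) (K : ℂ) : Prop :=
  ∃ z ∈ Lam η K, ∀ Y, E.IsSolution z Y → E.MemL2w Y.1 ∧ E.SimsFinite η K Y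

/-- The solution `(y, p y')` of `𝓜[y] = z y` with `y(a) = y₀`, `(p y')(a) = u₀`
(it exists and is unique on `[a, b)` since `a` is a regular endpoint). -/
def ivp (z y₀ u₀ : ℂ) : (ℝ → ℂ) × (ℝ → ℂ) :=
  Classical.epsilon fun Y => E.IsSolution z Y ∧ Y.1 E.a = y₀ ∧ Y.2 E.a = u₀

/-- For the boundary condition `c y(a) + s (p y')(a) = 0`: the solution `θ(·, z)`, with
`θ(a) = c`, `pθ'(a) = s`. -/
def theta (c s z : ℂ) : (ℝ → ℂ) × (ℝ → ℂ) := E.ivp z c s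

/-- For the boundary condition `c y(a) + s (p y')(a) = 0`: the solution `φ(·, z)`, with
`φ(a) = s`, `pφ'(a) = -c`, which satisfies that boundary condition. -/
def phi (c s z : ℂ) : (ℝ → ℂ) × (ℝ → ℂ) := E.ivp z s (-c)

/-- `ψ = θ(·, z) + m φ(·, z)`, together with its quasi-derivative. -/
def psi (c s z m : ℂ) : (ℝ → ℂ) × (ℝ → ℂ) := E.theta c s z + m • E.phi c s z

/-- The Wronskian `[u, v] = p (u v' - u' v)`, for `U = (u, p u')` and `V = (v, p v')`. -/
def wronskian (U V : (ℝ → ℂ) × (ℝ → ℂ)) (x : ℝ) : ℂ := U.1 x * V.2 x - U.2 x * V.1 x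

/-- The boundary condition `[y, Ψ](b) = 0`, with `[y, Ψ](b) = lim_{x → b} [y, Ψ](x)`. -/
def BCAtEnd (Ψ Y : (ℝ → ℂ) × (ℝ → ℂ)) : Prop :=
  Tendsto (fun x => wronskian Y Ψ x) E.toEnd (𝓝 0)

/-- `y` lies in the domain of the realization of `𝓜` in `L²_w[a, b)` with boundary conditions
`c y(a) + s (p y')(a) = 0` and `[y, Ψ](b) = 0`, and is mapped to `f`. -/
structure IsRealizationGraph (c s : ℂ) (Ψ : (ℝ → ℂ) × (ℝ → ℂ))
    (Y : (ℝ → ℂ) × (ℝ → ℂ)) (f : ℝ → ℂ) : Prop where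
  image : E.IsImage Y f
  mem_domain : E.MemL2w Y.1
  mem_range : E.MemL2w f
  bc_a : c * Y.1 E.a + s * Y.2 E.a = 0
  bc_b : E.BCAtEnd Ψ Y

/-- `z` is an eigenvalue of that realization. -/
def IsEigenvalue (c s : ℂ) (Ψ : (ℝ → ℂ) × (ℝ → ℂ)) (z : ℂ) : Prop :=
  ∃ Y, E.IsRealizationGraph c s Ψ Y (fun x => z * Y.1 x) ∧ ∃ x ∈ E.I, Y.1 x ≠ 0

/-- `m` is a value at `z` of the Titchmarsh-Weyl function of that realization:
`θ(·, z) + m φ(·, z)` lies in `L²_w[a, b)` and satisfies the boundary condition at `b`. -/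
def IsTWValue (c s : ℂ) (Ψ : (ℝ → ℂ) × (ℝ → ℂ)) (z m : ℂ) : Prop :=
  E.MemL2w (E.psi c s z m).1 ∧ E.BCAtEnd Ψ (E.psi c s z m)

/-- The Titchmarsh-Weyl function of that realization (where it is defined). -/
def twFunction (c s : ℂ) (Ψ : (ℝ → ℂ) × (ℝ → ℂ)) (z : ℂ) : ℂ :=
  Classical.epsilon fun m => E.IsTWValue c s Ψ z m

/-- `m` is a value at `z` of the Titchmarsh-Weyl function of the regular problem on `[a, d]` with
boundary conditions `c y(a) + s (p y')(a) = 0` and `[y, Ψ](d) = 0`: the solution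
`θ(·, z) + m φ(·, z)` satisfies the boundary condition at `d`. -/
def IsTruncTWValue (c s : ℂ) (Ψ : (ℝ → ℂ) × (ℝ → ℂ)) (d : ℝ) (z m : ℂ) : Prop :=
  wronskian (E.psi c s z m) Ψ d = 0

/-- The Titchmarsh-Weyl function of the regular problem on `[a, d]` (where it is defined). -/
def truncTWFunction (c s : ℂ) (Ψ : (ℝ → ℂ) × (ℝ → ℂ)) (d : ℝ) (z : ℂ) : ℂ :=
  Classical.epsilon fun m => E.IsTruncTWValue c s Ψ d z m

end SturmLiouville

end


/-! In Sims Cases II and III all solutions are in `L²_w` for one spectral parameter, hence for every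
one: if `u`, `v` solve the equation for `z₀` with `[u, v] = 1`, a solution `y` for `z` is
`[y, v] u - [y, u] v`, and these coefficients stay bounded by Gronwall's inequality, because
`[y, u]' = (z - z₀) w y u` and `w (|u| + |v|)²` is integrable. By the same derivative formula,
`[y₁, y₂](b)` exists for solutions `y₁`, `y₂` for any two spectral parameters.

Therefore `[θ + m φ, ψ](x) = [θ, ψ](x) + m [φ, ψ](x)` converges as `x → b`. If `z` is not an
eigenvalue, then `[φ, ψ](b) ≠ 0`, as `φ` would be an eigenfunction otherwise; so `m(z)` is
`-[θ, ψ](b) / [φ, ψ](b)`, the limit of `mₙ(z) = -[θ, ψ](bₙ) / [φ, ψ](bₙ)`. -/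

theorem add_mul_eq_zero_iff {K : Type*} [Field K] {A B m : K} (hB : B ≠ 0) :
    A + m * B = 0 ↔ m = -A / B := by
  rw [eq_div_iff hB, ← add_eq_zero_iff_eq_neg, add_comm]

theorem ne_zero_or_ne_zero_of_sq_add_sq_ne_zero {R : Type*} [Semiring R] {c s : R}
    (h : c ^ 2 + s ^ 2 ≠ 0) : c ≠ 0 ∨ s ≠ 0 := by
  contrapose! h
  simp [h.1, h.2]

theorem epsilon_eq_of_forall_iff {α : Type*} [Nonempty α] {P : α → Prop} {a₀ : α}
    (h : ∀ a, P a ↔ a = a₀) : Classical.epsilon P = a₀ :=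
  (h _).1 (Classical.epsilon_spec ⟨a₀, (h a₀).2 rfl⟩)

theorem existsUnique_of_forall_iff {α : Type*} {P : α → Prop} {a₀ : α}
    (h : ∀ a, P a ↔ a = a₀) : ∃! a, P a :=
  ⟨a₀, (h a₀).2 rfl, fun a ↦ (h a).1⟩
section AbsolutelyContinuous

variable {F : Type*} [NormedAddCommGroup F] {a b : ℝ}

theorem absolutelyContinuousOnInterval_of_dist_le {X Y : Type*} [PseudoMetricSpace X]
    [PseudoMetricSpace Y] {f : ℝ → X} {g : ℝ → Y} (hf : AbsolutelyContinuousOnInterval f a b)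
    (C : ℝ) (h : ∀ x ∈ uIcc a b, ∀ y ∈ uIcc a b, dist (g x) (g y) ≤ C * dist (f x) (f y)) :
    AbsolutelyContinuousOnInterval g a b := by
  have hC : Tendsto (fun P : ℕ × (ℕ → ℝ × ℝ) ↦
      C * ∑ i ∈ Finset.range P.1, dist (f (P.2 i).1) (f (P.2 i).2))
      (AbsolutelyContinuousOnInterval.totalLengthFilter ⊓
        𝓟 (AbsolutelyContinuousOnInterval.disjWithin a b)) (𝓝 0) := by
    simpa only [mul_zero] using Tendsto.const_mul C hf
  refine squeeze_zero' (Eventually.of_forall fun P ↦ Finset.sum_nonneg fun _ _ ↦ dist_nonneg) ?_ hC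
  filter_upwards [mem_inf_of_right (mem_principal_self _)] with P hP
  rw [Finset.mul_sum]
  exact Finset.sum_le_sum fun i hi ↦ h _ (hP.1 i hi).1 _ (hP.1 i hi).2

theorem absolutelyContinuousOnInterval_contDiff_comp {G : Type*} [NormedAddCommGroup G]
    [NormedSpace ℝ G] {φ : ℝ → G} {k : ℝ → ℝ} (hφ : ContDiff ℝ 1 φ)
    (hk : AbsolutelyContinuousOnInterval k a b) :
    AbsolutelyContinuousOnInterval (fun x ↦ φ (k x)) a b := by
  obtain ⟨M, hM⟩ := hk.exists_bound
  obtain ⟨L, hL⟩ := (hφ.contDiffOn (s := Icc (-M) M)).exists_lipschitzOnWith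
    one_ne_zero (convex_Icc _ _) isCompact_Icc
  exact absolutelyContinuousOnInterval_of_dist_le hk L fun x hx y hy ↦
    hL.dist_le_mul _ (abs_le.1 (hM x hx)) _ (abs_le.1 (hM y hy))

theorem absolutelyContinuousOnInterval_prodMk {G : Type*} [NormedAddCommGroup G] {f : ℝ → F}
    {g : ℝ → G} (hf : AbsolutelyContinuousOnInterval f a b)
    (hg : AbsolutelyContinuousOnInterval g a b) :
    AbsolutelyContinuousOnInterval (fun x ↦ (f x, g x)) a b := by
  have hl : AbsolutelyContinuousOnInterval (fun x ↦ (f x, (0 : G))) a b :=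
    absolutelyContinuousOnInterval_of_dist_le hf 1 fun x _ y _ ↦ by simp [Prod.dist_eq]
  have hr : AbsolutelyContinuousOnInterval (fun x ↦ ((0 : F), g x)) a b :=
    absolutelyContinuousOnInterval_of_dist_le hg 1 fun x _ y _ ↦ by simp [Prod.dist_eq]
  simpa only [Prod.mk_add_mk, add_zero, zero_add] using hl.fun_add hr

variable [NormedSpace ℝ F]

theorem absolutelyContinuousOnInterval_integral {f : ℝ → F}
    (hf : IntervalIntegrable f volume a b) :
    AbsolutelyContinuousOnInterval (fun x ↦ ∫ t in a..x, f t) a b := by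
  have hsub : ∀ x ∈ uIcc a b, IntervalIntegrable f volume a x := fun x hx ↦
    hf.mono_set (uIcc_subset_uIcc left_mem_uIcc hx)
  refine absolutelyContinuousOnInterval_of_dist_le
    (hf.norm.absolutelyContinuousOnInterval_intervalIntegral left_mem_uIcc) 1 fun x hx y hy ↦ ?_
  rw [dist_comm, dist_comm (∫ t in a..x, ‖f t‖), dist_eq_norm, dist_eq_norm,
    intervalIntegral.integral_interval_sub_left (hsub y hy) (hsub x hx),
    intervalIntegral.integral_interval_sub_left (hsub y hy).norm (hsub x hx).norm, one_mul,
    Real.norm_eq_abs]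
  exact intervalIntegral.norm_integral_le_abs_integral_norm

theorem eq_add_integral_of_ae_hasDerivAt [CompleteSpace F] {f f' : ℝ → F}
    (hf : AbsolutelyContinuousOnInterval f a b) (hf' : IntervalIntegrable f' volume a b)
    (hderiv : ∀ᵐ x, x ∈ uIcc a b → HasDerivAt f (f' x) x) :
    f b = f a + ∫ t in a..b, f' t := by
  obtain ⟨C, hC⟩ :=
    (hf.fun_sub (absolutelyContinuousOnInterval_integral hf')).const_of_ae_hasDerivAt_zero (by
      filter_upwards [hderiv, hf'.ae_hasDerivAt_integral] with x h₁ h₂ hx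
      simpa only [sub_self] using (h₁ hx).fun_sub (h₂ hx a left_mem_uIcc))
  have ha := hC a left_mem_uIcc
  rw [intervalIntegral.integral_same, sub_zero] at ha
  rw [ha]
  exact eq_add_of_sub_eq (hC b right_mem_uIcc)

theorem integral_mul_integral_pow {κ : ℝ → ℝ} (hκ : IntervalIntegrable κ volume a b) (n : ℕ) :
    ∫ x in a..b, κ x * (∫ t in a..x, κ t) ^ n = (∫ x in a..b, κ x) ^ (n + 1) / (n + 1) := by
  have hk := absolutelyContinuousOnInterval_integral hκ
  have hpow : ContDiff ℝ 1 fun x : ℝ ↦ x ^ (n + 1) / (n + 1) := by fun_prop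
  have hFTC := eq_add_integral_of_ae_hasDerivAt
    (absolutelyContinuousOnInterval_contDiff_comp hpow hk)
    (hκ.mul_continuousOn (hk.continuousOn.fun_pow n)) (by
      filter_upwards [hκ.ae_hasDerivAt_integral] with x h hx
      refine (((h hx a left_mem_uIcc).fun_pow (n + 1)).div_const _).congr_deriv ?_
      push_cast
      field_simp)
  simpa using hFTC.symm

theorem le_mul_exp_integral_of_ae_deriv_le {g κ : ℝ → ℝ} (hab : a ≤ b)
    (hg : AbsolutelyContinuousOnInterval g a b) (hκ : IntervalIntegrable κ volume a b)
    (h : ∀ᵐ x, x ∈ uIcc a b → deriv g x ≤ κ x * g x) :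
    g b ≤ g a * Real.exp (∫ x in a..b, κ x) := by
  have hexp : ContDiff ℝ 1 fun x : ℝ ↦ Real.exp (-x) := by fun_prop
  have hG := hg.fun_mul (absolutelyContinuousOnInterval_contDiff_comp hexp
    (absolutelyContinuousOnInterval_integral hκ))
  have hnonpos : ∫ x in a..b, deriv (fun x ↦ g x * Real.exp (-∫ t in a..x, κ t)) x ≤ 0 := by
    rw [intervalIntegral.integral_of_le hab]
    refine integral_nonpos_of_ae ((ae_restrict_iff' measurableSet_Ioc).2 ?_)
    filter_upwards [h, hg.ae_differentiableAt, hκ.ae_hasDerivAt_integral] with x hle hd hI hx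
    replace hx : x ∈ uIcc a b := Icc_subset_uIcc (Ioc_subset_Icc_self hx)
    rw [((hd hx).hasDerivAt.fun_mul (hI hx a left_mem_uIcc).fun_neg.exp).deriv, Pi.zero_apply]
    calc deriv g x * Real.exp (-∫ t in a..x, κ t) +
          g x * (Real.exp (-∫ t in a..x, κ t) * -κ x)
        = (deriv g x - κ x * g x) * Real.exp (-∫ t in a..x, κ t) := by ring
      _ ≤ 0 := mul_nonpos_of_nonpos_of_nonneg (sub_nonpos.2 (hle hx)) (Real.exp_pos _).le
  rw [hG.integral_deriv_eq_sub, intervalIntegral.integral_same, neg_zero, Real.exp_zero, mul_one,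
    sub_nonpos, Real.exp_neg, ← div_eq_mul_inv, div_le_iff₀ (Real.exp_pos _)] at hnonpos
  exact hnonpos

theorem deriv_norm_le {f : ℝ → F} {f' : F} {x : ℝ} (hf : HasDerivAt f f' x)
    (hn : DifferentiableAt ℝ (fun y ↦ ‖f y‖) x) : deriv (fun y ↦ ‖f y‖) x ≤ ‖f'‖ := by
  refine le_of_tendsto_of_tendsto' hn.hasDerivAt.tendsto_slope hf.tendsto_slope.norm fun y ↦ ?_
  rw [slope_def_field, slope_def_module, norm_smul, norm_inv, ← div_eq_inv_mul]
  refine (le_abs_self _).trans ?_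
  rw [abs_div, Real.norm_eq_abs]
  gcongr
  exact abs_norm_sub_norm_le _ _

theorem norm_le_norm_mul_exp_integral {f f' : ℝ → F} {κ : ℝ → ℝ} (hab : a ≤ b)
    (hf : AbsolutelyContinuousOnInterval f a b) (hκ : IntervalIntegrable κ volume a b)
    (hderiv : ∀ᵐ x, x ∈ uIcc a b → HasDerivAt f (f' x) x)
    (hle : ∀ᵐ x, x ∈ uIcc a b → ‖f' x‖ ≤ κ x * ‖f x‖) :
    ‖f b‖ ≤ ‖f a‖ * Real.exp (∫ x in a..b, κ x) := by
  have hn : AbsolutelyContinuousOnInterval (fun x ↦ ‖f x‖) a b :=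
    absolutelyContinuousOnInterval_of_dist_le hf 1 fun x _ y _ ↦ by
      rw [one_mul, dist_eq_norm (f x)]
      exact dist_norm_norm_le (f x) (f y)
  refine le_mul_exp_integral_of_ae_deriv_le hab hn hκ ?_
  filter_upwards [hn.ae_differentiableAt, hderiv, hle] with x hd h₁ h₂ hx
  exact (deriv_norm_le (h₁ hx) (hd hx)).trans (h₂ hx)

end AbsolutelyContinuous

section LinearSystem

variable {F : Type*} [NormedAddCommGroup F] [NormedSpace ℝ F] {A : ℝ → F →L[ℝ] F} {a b : ℝ}
  {y₀ : F}

/-- The increments of the Picard iteration for the linear initial value problem `Y' = A Y`,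
`Y a = y₀`; the iterates themselves are the partial sums. -/
noncomputable def picardIncrement (A : ℝ → F →L[ℝ] F) (a : ℝ) (y₀ : F) : ℕ → ℝ → F
  | 0 => fun _ ↦ y₀
  | n + 1 => fun x ↦ ∫ t in a..x, A t (picardIncrement A a y₀ n t)

theorem intervalIntegrable_clm_apply {Y : ℝ → F} (hA : IntervalIntegrable A volume a b)
    (hY : ContinuousOn Y (uIcc a b)) : IntervalIntegrable (fun t ↦ A t (Y t)) volume a b := by
  rw [intervalIntegrable_iff] at hA ⊢
  obtain ⟨C, hC⟩ := isCompact_uIcc.exists_bound_of_continuousOn hY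
  refine (ContinuousLinearMap.id ℝ (F →L[ℝ] F)).integrable_of_bilin_of_bdd_right C hA
    ((hY.mono uIoc_subset_uIcc).aestronglyMeasurable measurableSet_uIoc) ?_
  exact (ae_restrict_mem measurableSet_uIoc).mono fun t ht ↦ hC t (uIoc_subset_uIcc ht)

theorem continuousOn_picardIncrement (hA : IntervalIntegrable A volume a b) (n : ℕ) :
    ContinuousOn (picardIncrement A a y₀ n) (uIcc a b) := by
  induction n with
  | zero => exact continuousOn_const
  | succ n ih =>
    exact (absolutelyContinuousOnInterval_integral
      (intervalIntegrable_clm_apply hA ih)).continuousOn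

theorem norm_picardIncrement_le (hA : IntervalIntegrable A volume a b) (n : ℕ) {x : ℝ}
    (hx : x ∈ Icc a b) :
    ‖picardIncrement A a y₀ n x‖ ≤ ‖y₀‖ * ((∫ t in a..x, ‖A t‖) ^ n / n.factorial) := by
  induction n generalizing x with
  | zero => simp [picardIncrement]
  | succ n ih =>
    have hκ : IntervalIntegrable (fun t ↦ ‖A t‖) volume a x :=
      hA.norm.mono_set (uIcc_subset_uIcc left_mem_uIcc (Icc_subset_uIcc hx))
    have hk := (absolutelyContinuousOnInterval_integral hκ).continuousOn
    calc ‖∫ t in a..x, A t (picardIncrement A a y₀ n t)‖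
        ≤ ∫ t in a..x, ‖y₀‖ / n.factorial * (‖A t‖ * (∫ τ in a..t, ‖A τ‖) ^ n) := by
          refine intervalIntegral.norm_integral_le_of_norm_le hx.1 (ae_of_all _ fun t ht ↦ ?_)
            ((hκ.mul_continuousOn (hk.pow n)).const_mul _)
          calc ‖A t (picardIncrement A a y₀ n t)‖
              ≤ ‖A t‖ * (‖y₀‖ * ((∫ τ in a..t, ‖A τ‖) ^ n / n.factorial)) :=
                (A t).le_opNorm_of_le (ih ⟨ht.1.le, ht.2.trans hx.2⟩)
            _ = _ := by ring
      _ = ‖y₀‖ * ((∫ t in a..x, ‖A t‖) ^ (n + 1) / (n + 1).factorial) := by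
          rw [intervalIntegral.integral_const_mul, integral_mul_integral_pow hκ,
            Nat.factorial_succ]
          push_cast
          field_simp

theorem norm_picardIncrement_le_of_mem_Icc (hA : IntervalIntegrable A volume a b) (n : ℕ) {x : ℝ}
    (hx : x ∈ Icc a b) :
    ‖picardIncrement A a y₀ n x‖ ≤ ‖y₀‖ * ((∫ t in a..b, ‖A t‖) ^ n / n.factorial) := by
  refine (norm_picardIncrement_le hA n hx).trans ?_
  have hmono : ∫ t in a..x, ‖A t‖ ≤ ∫ t in a..b, ‖A t‖ :=
    intervalIntegral.integral_mono_interval le_rfl hx.1 hx.2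
      (ae_of_all _ fun t ↦ norm_nonneg (A t)) hA.norm
  have hnonneg : 0 ≤ ∫ t in a..x, ‖A t‖ :=
    intervalIntegral.integral_nonneg hx.1 fun t _ ↦ norm_nonneg (A t)
  gcongr

theorem summable_picardIncrement_bound (A : ℝ → F →L[ℝ] F) (a b : ℝ) (y₀ : F) :
    Summable fun n : ℕ ↦ ‖y₀‖ * ((∫ t in a..b, ‖A t‖) ^ n / n.factorial) :=
  (Real.summable_pow_div_factorial _).mul_left _

theorem continuousOn_tsum_picardIncrement [CompleteSpace F] (hab : a ≤ b)
    (hA : IntervalIntegrable A volume a b) :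
    ContinuousOn (fun x ↦ ∑' n, picardIncrement A a y₀ n x) (uIcc a b) := by
  refine continuousOn_tsum (continuousOn_picardIncrement hA)
    (summable_picardIncrement_bound A a b y₀) fun n x hx ↦ ?_
  exact norm_picardIncrement_le_of_mem_Icc hA n (uIcc_of_le hab ▸ hx)

theorem tsum_picardIncrement_eq [CompleteSpace F] (hab : a ≤ b)
    (hA : IntervalIntegrable A volume a b) :
    ∑' n, picardIncrement A a y₀ n b =
      y₀ + ∫ t in a..b, A t (∑' n, picardIncrement A a y₀ n t) := by
  have hbound := summable_picardIncrement_bound A a b y₀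
  have hmem : ∀ t ∈ uIoc a b, t ∈ Icc a b := fun t ht ↦
    uIcc_of_le hab ▸ uIoc_subset_uIcc ht
  have hint : HasSum (fun n ↦ picardIncrement A a y₀ (n + 1) b)
      (∫ t in a..b, A t (∑' n, picardIncrement A a y₀ n t)) := by
    refine intervalIntegral.hasSum_integral_of_dominated_convergence
      (fun n t ↦ ‖A t‖ * (‖y₀‖ * ((∫ t in a..b, ‖A t‖) ^ n / n.factorial))) (fun n ↦ ?_)
      (fun n ↦ ae_of_all _ fun t ht ↦ ?_) (ae_of_all _ fun t _ ↦ hbound.mul_left _) ?_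
      (ae_of_all _ fun t ht ↦ ?_)
    · exact (intervalIntegrable_clm_apply hA
        (continuousOn_picardIncrement hA n)).def'.aestronglyMeasurable
    · exact (A t).le_opNorm_of_le (norm_picardIncrement_le_of_mem_Icc hA n (hmem t ht))
    · simp_rw [tsum_mul_left]
      exact hA.norm.mul_const _
    · exact (Summable.of_norm_bounded hbound fun n ↦
        norm_picardIncrement_le_of_mem_Icc hA n (hmem t ht)).hasSum.mapL (A t)
  exact (hint.zero_add (f := fun n ↦ picardIncrement A a y₀ n b)).tsum_eq

end LinearSystem

namespace SturmLiouville

variable {E : SturmLiouville}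

section Interval

theorem measurableSet_I : MeasurableSet E.I :=
  measurableSet_Ici.inter (measurable_coe_real_ereal measurableSet_Iio)

theorem Icc_subset_I {x : ℝ} (hx : x ∈ E.I) : Icc E.a x ⊆ E.I :=
  fun _ ht ↦ ⟨ht.1, (EReal.coe_le_coe_iff.2 ht.2).trans_lt hx.2⟩

theorem uIcc_subset_I {x : ℝ} (hx : x ∈ E.I) : uIcc E.a x ⊆ E.I := by
  rw [uIcc_of_le hx.1]
  exact Icc_subset_I hx

theorem exists_mem_I_gt {x : ℝ} (hx : x ∈ E.I) : ∃ r ∈ E.I, x < r := by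
  obtain ⟨r, hxr, hrb⟩ := EReal.lt_iff_exists_real_btwn.1 hx.2
  rw [EReal.coe_lt_coe_iff] at hxr
  exact ⟨r, ⟨hx.1.trans hxr.le, hrb⟩, hxr⟩

theorem exists_uIcc_mem_nhdsWithin_I {x : ℝ} (hx : x ∈ E.I) :
    ∃ r ∈ E.I, uIcc E.a r ∈ 𝓝[E.I] x := by
  obtain ⟨r, hr, hxr⟩ := exists_mem_I_gt hx
  refine ⟨r, hr, ?_⟩
  filter_upwards [self_mem_nhdsWithin, mem_nhdsWithin_of_mem_nhds (Iic_mem_nhds hxr)] with t ht htr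
  exact Icc_subset_uIcc ⟨ht.1, htr⟩

theorem ae_restrict_I_iff {P : ℝ → Prop} :
    (∀ᵐ x ∂volume.restrict E.I, P x) ↔ ∀ x ∈ E.I, ∀ᵐ t, t ∈ uIcc E.a x → P t := by
  rw [ae_restrict_iff' measurableSet_I]
  refine ⟨fun h x hx ↦ h.mono fun t ht htx ↦ ht (uIcc_subset_I hx htx), fun h ↦ ?_⟩
  refine measure_null_of_locally_null _ fun x hx ↦ ?_
  have hsub : {t | t ∈ E.I → P t}ᶜ ⊆ E.I := fun t ht ↦ (Classical.not_imp.1 ht).1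
  obtain ⟨r, hr, hnhds⟩ := exists_uIcc_mem_nhdsWithin_I (hsub hx)
  refine ⟨_, inter_mem (nhdsWithin_mono x hsub hnhds) self_mem_nhdsWithin, ?_⟩
  refine measure_mono_null (t := {t | t ∈ uIcc E.a r → P t}ᶜ) ?_ (h r hr)
  exact fun t ht htP ↦ (Classical.not_imp.1 ht.2).2 (htP ht.1)

theorem intervalIntegrable_of_mem_I {F : Type*} [NormedAddCommGroup F] {f : ℝ → F}
    (hf : LocallyIntegrableOn f E.I) {x : ℝ} (hx : x ∈ E.I) :
    IntervalIntegrable f volume E.a x :=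
  (hf.integrableOn_compact_subset (uIcc_subset_I hx) isCompact_uIcc).intervalIntegrable

theorem continuousOn_I {X : Type*} [TopologicalSpace X] {f : ℝ → X}
    (hf : ∀ x ∈ E.I, ContinuousOn f (uIcc E.a x)) : ContinuousOn f E.I := by
  intro x hx
  obtain ⟨r, hr, hnhds⟩ := exists_uIcc_mem_nhdsWithin_I hx
  exact (hf r hr x (mem_of_mem_nhdsWithin hx hnhds)).mono_of_mem_nhdsWithin hnhds

theorem tendsto_toEnd {ι : Type*} {l : Filter ι} {d : ι → ℝ} (hlt : ∀ i, (d i : EReal) < E.b)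
    (hlim : Tendsto (fun i ↦ (d i : EReal)) l (𝓝 E.b)) : Tendsto d l E.toEnd :=
  tendsto_comap_iff.2 (tendsto_nhdsWithin_iff.2 ⟨hlim, Eventually.of_forall hlt⟩)

theorem toEnd_neBot (hab : (E.a : EReal) < E.b) : E.toEnd.NeBot := by
  refine comap_neBot_iff.2 fun t ht ↦ ?_
  obtain ⟨l, hl, hsub⟩ := (mem_nhdsLT_iff_exists_Ioo_subset' hab).1 ht
  obtain ⟨x, hx⟩ := EReal.lt_iff_exists_real_btwn.1 hl
  exact ⟨x, hsub hx⟩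

theorem eventually_toEnd_gt {t : ℝ} (ht : (t : EReal) < E.b) :
    ∀ᶠ x in E.toEnd, t < x ∧ (x : EReal) < E.b := by
  have hIoo : ∀ᶠ y in 𝓝[<] E.b, y ∈ Ioo (t : EReal) E.b := Ioo_mem_nhdsLT ht
  exact (hIoo.comap _).mono fun _ hx ↦ ⟨EReal.coe_lt_coe_iff.1 hx.1, hx.2⟩

theorem eventually_toEnd_mem_I (hab : (E.a : EReal) < E.b) : ∀ᶠ x in E.toEnd, x ∈ E.I :=
  (eventually_toEnd_gt hab).mono fun _ hx ↦ ⟨hx.1.le, hx.2⟩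

theorem tendsto_integral_toEnd {F : Type*} [NormedAddCommGroup F] [NormedSpace ℝ F] {f : ℝ → F}
    (hab : (E.a : EReal) < E.b) (hf : IntegrableOn f E.I) :
    Tendsto (fun x ↦ ∫ t in E.a..x, f t) E.toEnd (𝓝 (∫ t in E.I, f t)) := by
  have : E.toEnd.IsCountablyGenerated := by unfold toEnd; infer_instance
  have hcover : AECover (volume.restrict E.I) E.toEnd Iic :=
    { ae_eventually_mem := by
        filter_upwards [ae_restrict_mem measurableSet_I] with t ht
        exact (eventually_toEnd_gt ht.2).mono fun x hx ↦ hx.1.le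
      measurableSet := fun x ↦ measurableSet_Iic }
  refine (hcover.integral_tendsto_of_countably_generated hf).congr' ?_
  filter_upwards [eventually_toEnd_mem_I hab] with x hx
  have hIcc : Iic x ∩ E.I = Icc E.a x :=
    Subset.antisymm (fun t ht ↦ ⟨ht.2.1, ht.1⟩) fun t ht ↦ ⟨ht.2, Icc_subset_I hx ht⟩
  rw [Measure.restrict_restrict measurableSet_Iic, hIcc, integral_Icc_eq_integral_Ioc,
    intervalIntegral.integral_of_le hx.1]

end Interval

/-- The part of `IsStandard` which makes `a` a regular endpoint and `w` a (possibly degenerate)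
weight, with no condition on `Q` and none on the behaviour of the coefficients at `b`. -/
structure HasRegularCoeffs (E : SturmLiouville) : Prop where
  a_lt_b : (E.a : EReal) < E.b
  w_nonneg : ∀ᵐ x ∂volume.restrict E.I, 0 ≤ E.w x
  p_ne_zero : ∀ᵐ x ∂volume.restrict E.I, E.p x ≠ 0
  w_loc : LocallyIntegrableOn E.w E.I
  p_inv_loc : LocallyIntegrableOn (fun x ↦ (E.p x)⁻¹) E.I
  q_loc : LocallyIntegrableOn E.q E.I

theorem IsStandard.hasRegularCoeffs (hE : E.IsStandard) : E.HasRegularCoeffs where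
  a_lt_b := hE.a_lt_b
  w_nonneg := hE.w_pos.mono fun _ ↦ le_of_lt
  p_ne_zero := hE.p_ne_zero
  w_loc := hE.w_loc
  p_inv_loc := hE.p_inv_loc
  q_loc := hE.q_loc

theorem HasRegularCoeffs.a_mem_I (hE : E.HasRegularCoeffs) : E.a ∈ E.I := ⟨le_rfl, hE.a_lt_b⟩

theorem HasRegularCoeffs.intervalIntegrable_ofReal_w (hE : E.HasRegularCoeffs) {x : ℝ}
    (hx : x ∈ E.I) : IntervalIntegrable (fun t ↦ (E.w t : ℂ)) volume E.a x :=
  have hw := intervalIntegrable_of_mem_I hE.w_loc hx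
  ⟨hw.1.ofReal, hw.2.ofReal⟩

section Solutions

variable {z z₁ z₂ : ℂ} {U V Y : (ℝ → ℂ) × (ℝ → ℂ)}

/-- The coefficient `A` of the first-order system `X' = A X` which `𝓜[y] = z y` becomes for
`X = (y, p y')`. -/
noncomputable def systemCoeff (E : SturmLiouville) (z : ℂ) (x : ℝ) : ℂ × ℂ →L[ℝ] ℂ × ℂ :=
  (E.p x)⁻¹ • (ContinuousLinearMap.inl ℝ ℂ ℂ ∘L ContinuousLinearMap.snd ℝ ℂ ℂ) +
    (E.q x - z * (E.w x : ℂ)) • (ContinuousLinearMap.inr ℝ ℂ ℂ ∘L ContinuousLinearMap.fst ℝ ℂ ℂ)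

theorem systemCoeff_apply (E : SturmLiouville) (z : ℂ) (x : ℝ) (X : ℂ × ℂ) :
    E.systemCoeff z x X = (X.2 / E.p x, E.q x * X.1 - (E.w x : ℂ) * (z * X.1)) := by
  ext <;> simp [systemCoeff] <;> ring

theorem HasRegularCoeffs.intervalIntegrable_systemCoeff (hE : E.HasRegularCoeffs) (z : ℂ) {x : ℝ}
    (hx : x ∈ E.I) : IntervalIntegrable (E.systemCoeff z) volume E.a x := by
  have hcoeff := (intervalIntegrable_of_mem_I hE.q_loc hx).sub
    ((hE.intervalIntegrable_ofReal_w hx).const_mul z)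
  exact ((intervalIntegrable_of_mem_I hE.p_inv_loc hx).smul_continuousOn continuousOn_const).add
    (hcoeff.smul_continuousOn continuousOn_const)

theorem isSolution_iff_system {X : ℝ → ℂ × ℂ} :
    E.IsSolution z (fun x ↦ (X x).1, fun x ↦ (X x).2) ↔
      (∀ x ∈ E.I, AbsolutelyContinuousOnInterval X E.a x) ∧
        ∀ᵐ x ∂volume.restrict E.I, HasDerivAt X (E.systemCoeff z x (X x)) x := by
  constructor
  · intro h
    refine ⟨fun x hx ↦ absolutelyContinuousOnInterval_prodMk (h.ac_fst x hx) (h.ac_snd x hx), ?_⟩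
    filter_upwards [h.deriv_fst, h.deriv_snd] with x h₁ h₂
    rw [systemCoeff_apply]
    exact h₁.prodMk h₂
  · rintro ⟨hac, hderiv⟩
    simp only [systemCoeff_apply] at hderiv
    refine ⟨fun x hx ↦ ?_, fun x hx ↦ ?_, ?_, ?_⟩
    · refine absolutelyContinuousOnInterval_of_dist_le (hac x hx) 1 fun s _ t _ ↦ ?_
      rw [one_mul, Prod.dist_eq]
      exact le_max_left _ _
    · refine absolutelyContinuousOnInterval_of_dist_le (hac x hx) 1 fun s _ t _ ↦ ?_
      rw [one_mul, Prod.dist_eq]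
      exact le_max_right _ _
    · exact hderiv.mono fun x hx ↦
        (hasFDerivAt_fst (𝕜 := ℝ) (E := ℂ) (F := ℂ) (p := X x)).comp_hasDerivAt x hx
    · exact hderiv.mono fun x hx ↦
        (hasFDerivAt_snd (𝕜 := ℝ) (E := ℂ) (F := ℂ) (p := X x)).comp_hasDerivAt x hx

theorem HasRegularCoeffs.exists_isSolution (hE : E.HasRegularCoeffs) (z y₀ u₀ : ℂ) :
    ∃ Y, E.IsSolution z Y ∧ Y.1 E.a = y₀ ∧ Y.2 E.a = u₀ := by
  let S : ℝ → ℂ × ℂ := fun x ↦ ∑' n, picardIncrement (E.systemCoeff z) E.a (y₀, u₀) n x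
  let X : ℝ → ℂ × ℂ := fun x ↦ (y₀, u₀) + ∫ t in E.a..x, E.systemCoeff z t (S t)
  have hSX : ∀ x ∈ E.I, S x = X x := fun x hx ↦
    tsum_picardIncrement_eq hx.1 (hE.intervalIntegrable_systemCoeff z hx)
  have hint : ∀ x ∈ E.I, IntervalIntegrable (fun t ↦ E.systemCoeff z t (S t)) volume E.a x := by
    intro x hx
    have hA := hE.intervalIntegrable_systemCoeff z hx
    exact intervalIntegrable_clm_apply hA (continuousOn_tsum_picardIncrement hx.1 hA)
  have hX : E.IsSolution z (fun x ↦ (X x).1, fun x ↦ (X x).2) := by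
    refine isSolution_iff_system.2 ⟨fun x hx ↦ ?_, ae_restrict_I_iff.2 fun x hx ↦ ?_⟩
    · exact absolutelyContinuousOnInterval_of_dist_le
        (absolutelyContinuousOnInterval_integral (hint x hx)) 1 fun s _ t _ ↦ by simp [X]
    · filter_upwards [(hint x hx).ae_hasDerivAt_integral] with t h ht
      rw [← hSX t (uIcc_subset_I hx ht)]
      exact (h ht E.a left_mem_uIcc).const_add (y₀, u₀)
  exact ⟨_, hX, by simp [X], by simp [X]⟩

theorem HasRegularCoeffs.ivp_spec (hE : E.HasRegularCoeffs) (z y₀ u₀ : ℂ) :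
    E.IsSolution z (E.ivp z y₀ u₀) ∧ (E.ivp z y₀ u₀).1 E.a = y₀ ∧ (E.ivp z y₀ u₀).2 E.a = u₀ :=
  Classical.epsilon_spec (hE.exists_isSolution z y₀ u₀)

theorem IsSolution.add_smul (hU : E.IsSolution z U) (hV : E.IsSolution z V) (m : ℂ) :
    E.IsSolution z (U + m • V) where
  ac_fst x hx := (hU.ac_fst x hx).add ((hV.ac_fst x hx).const_smul m)
  ac_snd x hx := (hU.ac_snd x hx).add ((hV.ac_snd x hx).const_smul m)
  deriv_fst := by
    filter_upwards [hU.deriv_fst, hV.deriv_fst] with x h₁ h₂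
    refine (h₁.add (h₂.const_smul m)).congr_deriv ?_
    simp only [Prod.snd_add, Prod.smul_snd, Pi.add_apply, Pi.smul_apply, smul_eq_mul]
    ring
  deriv_snd := by
    filter_upwards [hU.deriv_snd, hV.deriv_snd] with x h₁ h₂
    refine (h₁.add (h₂.const_smul m)).congr_deriv ?_
    simp only [Prod.fst_add, Prod.smul_fst, Pi.add_apply, Pi.smul_apply, smul_eq_mul]
    ring

theorem IsSolution.eq_zero (hE : E.HasRegularCoeffs) (hY : E.IsSolution z Y) (h₁ : Y.1 E.a = 0)
    (h₂ : Y.2 E.a = 0) {x : ℝ} (hx : x ∈ E.I) : Y.1 x = 0 := by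
  obtain ⟨hac, hderiv⟩ := isSolution_iff_system (X := fun x ↦ (Y.1 x, Y.2 x)) |>.1 hY
  have hgronwall := norm_le_norm_mul_exp_integral hx.1 (hac x hx)
    (hE.intervalIntegrable_systemCoeff z hx).norm (ae_restrict_I_iff.1 hderiv x hx)
    (ae_of_all _ fun t _ ↦ (E.systemCoeff z t).le_opNorm _)
  rw [h₁, h₂, Prod.mk_zero_zero, norm_zero, zero_mul, norm_le_zero_iff] at hgronwall
  exact congrArg Prod.fst hgronwall

theorem IsSolution.snd_eq_zero (hE : E.HasRegularCoeffs) (hY : E.IsSolution z Y)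
    (h : ∀ x ∈ E.I, Y.1 x = 0) : Y.2 E.a = 0 := by
  obtain ⟨r, hr, har⟩ := exists_mem_I_gt hE.a_mem_I
  have hae : Y.2 =ᵐ[volume.restrict (Icc E.a r)] 0 := by
    rw [← restrict_Ioo_eq_restrict_Icc]
    filter_upwards [ae_restrict_of_ae_restrict_of_subset
        (Ioo_subset_Icc_self.trans (Icc_subset_I hr)) (hE.p_ne_zero.and hY.deriv_fst),
      ae_restrict_mem measurableSet_Ioo] with t ⟨hp, hd⟩ ht
    have hzero : Y.1 =ᶠ[𝓝 t] fun _ ↦ 0 := by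
      filter_upwards [Icc_mem_nhds ht.1 ht.2] with τ hτ using h τ (Icc_subset_I hr hτ)
    have hquot := hd.unique (hzero.hasDerivAt_iff.2 (hasDerivAt_const t 0))
    exact (div_eq_zero_iff.1 hquot).resolve_right hp
  exact Measure.eqOn_Icc_of_ae_eq volume har.ne hae
    (uIcc_of_le hr.1 ▸ (hY.ac_snd r hr).continuousOn) continuousOn_const (left_mem_Icc.2 har.le)

theorem IsSolution.ac_wronskian (hU : E.IsSolution z₁ U) (hV : E.IsSolution z₂ V) {x : ℝ}
    (hx : x ∈ E.I) : AbsolutelyContinuousOnInterval (wronskian U V) E.a x :=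
  ((hU.ac_fst x hx).smul (hV.ac_snd x hx)).sub ((hU.ac_snd x hx).smul (hV.ac_fst x hx))

theorem IsSolution.hasDerivAt_wronskian (hU : E.IsSolution z₁ U) (hV : E.IsSolution z₂ V) :
    ∀ᵐ x ∂volume.restrict E.I,
      HasDerivAt (wronskian U V) ((z₁ - z₂) * ((E.w x : ℂ) * (U.1 x * V.1 x))) x := by
  filter_upwards [hU.deriv_fst, hU.deriv_snd, hV.deriv_fst, hV.deriv_snd] with x h₁ h₂ h₃ h₄
  refine ((h₁.mul h₄).sub (h₂.mul h₃)).congr_deriv ?_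
  ring

theorem wronskian_eq_add_integral (hE : E.HasRegularCoeffs) (hU : E.IsSolution z₁ U)
    (hV : E.IsSolution z₂ V) {x : ℝ} (hx : x ∈ E.I) :
    wronskian U V x =
      wronskian U V E.a + ∫ t in E.a..x, (z₁ - z₂) * ((E.w t : ℂ) * (U.1 t * V.1 t)) := by
  have hUV := (hU.ac_fst x hx).continuousOn.mul (hV.ac_fst x hx).continuousOn
  exact eq_add_integral_of_ae_hasDerivAt (hU.ac_wronskian hV hx)
    (((hE.intervalIntegrable_ofReal_w hx).mul_continuousOn hUV).const_mul _)
    (ae_restrict_I_iff.1 (hU.hasDerivAt_wronskian hV) x hx)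

theorem wronskian_eq_wronskian_left_endpoint (hE : E.HasRegularCoeffs) (hU : E.IsSolution z U)
    (hV : E.IsSolution z V) {x : ℝ} (hx : x ∈ E.I) : wronskian U V x = wronskian U V E.a := by
  simp [wronskian_eq_add_integral hE hU hV hx]

theorem wronskian_add_smul_left (U V Y : (ℝ → ℂ) × (ℝ → ℂ)) (m : ℂ) (x : ℝ) :
    wronskian (U + m • V) Y x = wronskian U Y x + m * wronskian V Y x := by
  simp only [wronskian, Prod.fst_add, Prod.snd_add, Prod.smul_fst, Prod.smul_snd, Pi.add_apply,
    Pi.smul_apply, smul_eq_mul]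
  ring

end Solutions

section SquareIntegrable

variable {z₁ z₂ : ℂ} {U V : (ℝ → ℂ) × (ℝ → ℂ)} {f g h : ℝ → ℂ}

theorem HasRegularCoeffs.integrable_withDensity_iff (hE : E.HasRegularCoeffs) {F : Type*}
    [NormedAddCommGroup F] [NormedSpace ℝ F] {f : ℝ → F} :
    Integrable f ((volume.restrict E.I).withDensity fun x ↦ ENNReal.ofReal (E.w x)) ↔
      IntegrableOn (fun x ↦ E.w x • f x) E.I := by
  rw [integrable_withDensity_iff_integrable_smul₀'
    hE.w_loc.aestronglyMeasurable.aemeasurable.ennreal_ofReal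
    (ae_of_all _ fun _ ↦ ENNReal.ofReal_lt_top)]
  refine integrable_congr ?_
  filter_upwards [hE.w_nonneg] with x hx
  rw [ENNReal.toReal_ofReal hx]

theorem HasRegularCoeffs.integrableOn_mul (hE : E.HasRegularCoeffs) (hf : E.MemL2w f)
    (hg : E.MemL2w g) : IntegrableOn (fun x ↦ (E.w x : ℂ) * (f x * g x)) E.I := by
  have hfg := hE.integrable_withDensity_iff.1 (MemLp.integrable_mul hf hg)
  simpa only [Complex.real_smul, Pi.mul_apply] using hfg

theorem HasRegularCoeffs.integrableOn_mul_norm_add_norm_sq (hE : E.HasRegularCoeffs)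
    (hf : E.MemL2w f) (hg : E.MemL2w g) :
    IntegrableOn (fun x ↦ E.w x * (‖f x‖ + ‖g x‖) ^ 2) E.I :=
  hE.integrable_withDensity_iff.1 (MemLp.integrable_sq (hf.norm.add hg.norm))

theorem MemL2w.of_norm_le (hf : E.MemL2w f) (hg : E.MemL2w g) (hh : ContinuousOn h E.I) (C : ℝ)
    (hle : ∀ x ∈ E.I, ‖h x‖ ≤ C * (‖f x‖ + ‖g x‖)) : E.MemL2w h := by
  have hac := withDensity_absolutelyContinuous (volume.restrict E.I)
    fun x ↦ ENNReal.ofReal (E.w x)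
  refine MemLp.of_le_mul (c := C) (hf.norm.add hg.norm)
    ((hh.aestronglyMeasurable measurableSet_I).mono_ac hac) (hac.ae_le ?_)
  filter_upwards [ae_restrict_mem measurableSet_I] with x hx
  rw [Pi.add_apply, Real.norm_of_nonneg (by positivity)]
  exact hle x hx

theorem HasRegularCoeffs.exists_tendsto_wronskian (hE : E.HasRegularCoeffs)
    (hU : E.IsSolution z₁ U) (hV : E.IsSolution z₂ V) (hU2 : E.MemL2w U.1) (hV2 : E.MemL2w V.1) :
    ∃ l, Tendsto (wronskian U V) E.toEnd (𝓝 l) := by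
  have hlim := (tendsto_integral_toEnd hE.a_lt_b
    ((hE.integrableOn_mul hU2 hV2).const_mul (z₁ - z₂))).const_add (wronskian U V E.a)
  refine ⟨_, hlim.congr' ?_⟩
  filter_upwards [eventually_toEnd_mem_I hE.a_lt_b] with x hx
  exact (wronskian_eq_add_integral hE hU hV hx).symm

end SquareIntegrable

/-- Weyl's limit-circle condition at `b` for the spectral parameter `z`. -/
def IsLimitCircle (E : SturmLiouville) (z : ℂ) : Prop :=
  ∀ Y, E.IsSolution z Y → E.MemL2w Y.1

section LimitCircle

variable {z z₀ : ℂ} {U V Y : (ℝ → ℂ) × (ℝ → ℂ)}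

theorem norm_fst_le_of_wronskian_eq_one {x : ℝ} (hUV : wronskian U V x = 1)
    (Y : (ℝ → ℂ) × (ℝ → ℂ)) :
    ‖Y.1 x‖ ≤ (‖U.1 x‖ + ‖V.1 x‖) * ‖(wronskian Y U x, wronskian Y V x)‖ := by
  have hY : Y.1 x = U.1 x * wronskian Y V x - V.1 x * wronskian Y U x := by
    calc Y.1 x = Y.1 x * wronskian U V x := by rw [hUV, mul_one]
      _ = U.1 x * wronskian Y V x - V.1 x * wronskian Y U x := by simp only [wronskian]; ring
  rw [hY, add_mul]
  refine (norm_sub_le _ _).trans (add_le_add ?_ ?_) <;> rw [norm_mul]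
  · exact mul_le_mul_of_nonneg_left (norm_snd_le (wronskian Y U x, wronskian Y V x))
      (norm_nonneg _)
  · exact mul_le_mul_of_nonneg_left (norm_fst_le (wronskian Y U x, wronskian Y V x))
      (norm_nonneg _)

theorem norm_deriv_wronskian_le {x : ℝ} (hw : 0 ≤ E.w x) (hUV : wronskian U V x = 1)
    {T : (ℝ → ℂ) × (ℝ → ℂ)} (hT : ‖T.1 x‖ ≤ ‖U.1 x‖ + ‖V.1 x‖) (k : ℂ) :
    ‖k * ((E.w x : ℂ) * (Y.1 x * T.1 x))‖ ≤
      ‖k‖ * (E.w x * (‖U.1 x‖ + ‖V.1 x‖) ^ 2) * ‖(wronskian Y U x, wronskian Y V x)‖ := by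
  rw [norm_mul, norm_mul, norm_mul, Complex.norm_of_nonneg hw]
  calc ‖k‖ * (E.w x * (‖Y.1 x‖ * ‖T.1 x‖))
      ≤ ‖k‖ * (E.w x * ((‖U.1 x‖ + ‖V.1 x‖) * ‖(wronskian Y U x, wronskian Y V x)‖ *
          (‖U.1 x‖ + ‖V.1 x‖))) := by
        gcongr
        exact norm_fst_le_of_wronskian_eq_one hUV Y
    _ = _ := by ring

theorem norm_le_norm_mul_exp_setIntegral_I {F : Type*} [NormedAddCommGroup F] [NormedSpace ℝ F]
    {f f' : ℝ → F} {κ : ℝ → ℝ} (hκ : IntegrableOn κ E.I)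
    (hκ_nonneg : ∀ᵐ t ∂volume.restrict E.I, 0 ≤ κ t)
    (hderiv : ∀ᵐ t ∂volume.restrict E.I, HasDerivAt f (f' t) t)
    (hle : ∀ᵐ t ∂volume.restrict E.I, ‖f' t‖ ≤ κ t * ‖f t‖) {x : ℝ} (hx : x ∈ E.I)
    (hf : AbsolutelyContinuousOnInterval f E.a x) :
    ‖f x‖ ≤ ‖f E.a‖ * Real.exp (∫ t in E.I, κ t) := by
  have hmono : ∫ t in E.a..x, κ t ≤ ∫ t in E.I, κ t := by
    rw [intervalIntegral.integral_of_le hx.1]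
    exact setIntegral_mono_set hκ hκ_nonneg
      (Ioc_subset_Icc_self.trans (Icc_subset_I hx)).eventuallyLE
  refine (norm_le_norm_mul_exp_integral hx.1 hf
    (intervalIntegrable_of_mem_I hκ.locallyIntegrableOn hx) (ae_restrict_I_iff.1 hderiv x hx)
    (ae_restrict_I_iff.1 hle x hx)).trans ?_
  gcongr

theorem norm_wronskian_pair_le (hE : E.HasRegularCoeffs) (hU : E.IsSolution z₀ U)
    (hV : E.IsSolution z₀ V) (hUV : wronskian U V E.a = 1) (hU2 : E.MemL2w U.1)
    (hV2 : E.MemL2w V.1) (hY : E.IsSolution z Y) {x : ℝ} (hx : x ∈ E.I) :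
    ‖(wronskian Y U x, wronskian Y V x)‖ ≤ ‖(wronskian Y U E.a, wronskian Y V E.a)‖ *
      Real.exp (∫ t in E.I, ‖z - z₀‖ * (E.w t * (‖U.1 t‖ + ‖V.1 t‖) ^ 2)) := by
  refine norm_le_norm_mul_exp_setIntegral_I
    (f := fun t ↦ (wronskian Y U t, wronskian Y V t))
    (f' := fun t ↦
      ((z - z₀) * ((E.w t : ℂ) * (Y.1 t * U.1 t)), (z - z₀) * ((E.w t : ℂ) * (Y.1 t * V.1 t))))
    ((hE.integrableOn_mul_norm_add_norm_sq hU2 hV2).const_mul _)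
    (hE.w_nonneg.mono fun t ht ↦ by positivity) ?_ ?_ hx
    (absolutelyContinuousOnInterval_prodMk (hY.ac_wronskian hU hx) (hY.ac_wronskian hV hx))
  · filter_upwards [hY.hasDerivAt_wronskian hU, hY.hasDerivAt_wronskian hV] with t h₁ h₂
    exact h₁.prodMk h₂
  · filter_upwards [hE.w_nonneg, ae_restrict_mem measurableSet_I] with t hw ht
    have hone := (wronskian_eq_wronskian_left_endpoint hE hU hV ht).trans hUV
    exact norm_prod_le_iff.2
      ⟨norm_deriv_wronskian_le hw hone (le_add_of_nonneg_right (norm_nonneg _)) _,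
        norm_deriv_wronskian_le hw hone (le_add_of_nonneg_left (norm_nonneg _)) _⟩

theorem memL2w_of_wronskian_eq_one (hE : E.HasRegularCoeffs) (hU : E.IsSolution z₀ U)
    (hV : E.IsSolution z₀ V) (hUV : wronskian U V E.a = 1) (hU2 : E.MemL2w U.1)
    (hV2 : E.MemL2w V.1) (hY : E.IsSolution z Y) : E.MemL2w Y.1 := by
  refine hU2.of_norm_le hV2 (continuousOn_I fun x hx ↦ (hY.ac_fst x hx).continuousOn)
    (‖(wronskian Y U E.a, wronskian Y V E.a)‖ *
      Real.exp (∫ t in E.I, ‖z - z₀‖ * (E.w t * (‖U.1 t‖ + ‖V.1 t‖) ^ 2))) fun x hx ↦ ?_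
  rw [mul_comm]
  have hone := (wronskian_eq_wronskian_left_endpoint hE hU hV hx).trans hUV
  exact (norm_fst_le_of_wronskian_eq_one hone Y).trans (mul_le_mul_of_nonneg_left
    (norm_wronskian_pair_le hE hU hV hUV hU2 hV2 hY hx) (by positivity))

theorem IsLimitCircle.of_isLimitCircle (hE : E.HasRegularCoeffs) (hz₀ : E.IsLimitCircle z₀)
    (z : ℂ) : E.IsLimitCircle z := by
  intro Y hY
  obtain ⟨hU, hU₁, hU₂⟩ := hE.ivp_spec z₀ 1 0
  obtain ⟨hV, hV₁, hV₂⟩ := hE.ivp_spec z₀ 0 1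
  have hUV : wronskian (E.ivp z₀ 1 0) (E.ivp z₀ 0 1) E.a = 1 := by
    simp [wronskian, hU₁, hU₂, hV₁, hV₂]
  exact memL2w_of_wronskian_eq_one hE hU hV hUV (hz₀ _ hU) (hz₀ _ hV) hY

theorem exists_isLimitCircle_of_simsCase {η : ℝ} {K : ℂ}
    (h : E.SimsCaseII η K ∨ E.SimsCaseIII η K) : ∃ z, E.IsLimitCircle z := by
  rcases h with ⟨z, -, h, -⟩ | ⟨z, -, h⟩
  exacts [⟨z, h⟩, ⟨z, fun Y hY ↦ (h Y hY).1⟩]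

end LimitCircle

section TitchmarshWeyl

variable {c s z z' m : ℂ} {Ψ Y : (ℝ → ℂ) × (ℝ → ℂ)}

theorem boundary_condition_iff_wronskian_eq_zero {κ : ℂ} {x : ℝ} (hcs : c ≠ 0 ∨ s ≠ 0)
    (hc : c = κ * Ψ.2 x) (hs : s = κ * -Ψ.1 x) :
    Y.1 x * c + Y.2 x * s = 0 ↔ wronskian Y Ψ x = 0 := by
  have hκ : κ ≠ 0 := by
    rintro rfl
    simp [hc, hs] at hcs
  have hW : Y.1 x * c + Y.2 x * s = κ * wronskian Y Ψ x := by
    rw [hc, hs, wronskian]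
    ring
  rw [hW, mul_eq_zero, or_iff_right hκ]

theorem HasRegularCoeffs.isSolution_theta (hE : E.HasRegularCoeffs) (c s z : ℂ) :
    E.IsSolution z (E.theta c s z) :=
  (hE.ivp_spec z c s).1

theorem HasRegularCoeffs.isSolution_phi (hE : E.HasRegularCoeffs) (c s z : ℂ) :
    E.IsSolution z (E.phi c s z) :=
  (hE.ivp_spec z s (-c)).1

theorem HasRegularCoeffs.isSolution_psi (hE : E.HasRegularCoeffs) (c s z m : ℂ) :
    E.IsSolution z (E.psi c s z m) :=
  (hE.isSolution_theta c s z).add_smul (hE.isSolution_phi c s z) m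

theorem HasRegularCoeffs.wronskian_psi_left_endpoint (hE : E.HasRegularCoeffs) (c s z m : ℂ)
    (Y : (ℝ → ℂ) × (ℝ → ℂ)) :
    wronskian Y (E.psi c s z m) E.a = Y.1 E.a * (s - m * c) - Y.2 E.a * (c + m * s) := by
  obtain ⟨-, hθ₁, hθ₂⟩ := hE.ivp_spec z c s
  obtain ⟨-, hφ₁, hφ₂⟩ := hE.ivp_spec z s (-c)
  simp only [wronskian, psi, theta, phi, Prod.fst_add, Prod.snd_add, Prod.smul_fst,
    Prod.smul_snd, Pi.add_apply, Pi.smul_apply, smul_eq_mul, hθ₁, hθ₂, hφ₁, hφ₂]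
  ring

theorem HasRegularCoeffs.isEigenvalue_of_bcAtEnd_phi (hE : E.HasRegularCoeffs)
    (hcs : c ≠ 0 ∨ s ≠ 0) (hφ : E.MemL2w (E.phi c s z).1) (h : E.BCAtEnd Ψ (E.phi c s z)) :
    E.IsEigenvalue c s Ψ z := by
  obtain ⟨hsol, hφ₁, hφ₂⟩ := hE.ivp_spec z s (-c)
  refine ⟨E.phi c s z, ⟨hsol, hφ, MemLp.const_mul hφ z, ?_, h⟩, ?_⟩
  · rw [phi, hφ₁, hφ₂]
    ring
  · by_contra! hzero
    have hc : c = 0 := neg_eq_zero.1 (hφ₂.symm.trans (hsol.snd_eq_zero hE hzero))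
    have hs : s = 0 := hφ₁.symm.trans (hzero E.a hE.a_mem_I)
    simp [hc, hs] at hcs

theorem HasRegularCoeffs.not_isEigenvalue_psi (hE : E.HasRegularCoeffs) (hcs : c ^ 2 + s ^ 2 ≠ 0)
    (z m : ℂ) : ¬ E.IsEigenvalue c s (E.psi c s z m) z := by
  rintro ⟨Y, hY, x, hx, hne⟩
  have hsol : E.IsSolution z Y := hY.image
  have hW : wronskian Y (E.psi c s z m) E.a = 0 := by
    have := toEnd_neBot hE.a_lt_b
    refine tendsto_nhds_unique (tendsto_const_nhds.congr' ?_) hY.bc_b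
    filter_upwards [eventually_toEnd_mem_I hE.a_lt_b] with t ht
    exact (wronskian_eq_wronskian_left_endpoint hE hsol (hE.isSolution_psi c s z m) ht).symm
  rw [hE.wronskian_psi_left_endpoint] at hW
  have h₁ : (c ^ 2 + s ^ 2) * Y.1 E.a = 0 := by
    linear_combination (c + m * s) * hY.bc_a + s * hW
  have h₂ : (c ^ 2 + s ^ 2) * Y.2 E.a = 0 := by
    linear_combination (s - m * c) * hY.bc_a - c * hW
  exact hne (hsol.eq_zero hE ((mul_eq_zero_iff_left hcs).1 h₁) ((mul_eq_zero_iff_left hcs).1 h₂) hx)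

theorem isTWValue_psi (hψ : E.MemL2w (E.psi c s z m).1) :
    E.IsTWValue c s (E.psi c s z m) z m := by
  refine ⟨hψ, tendsto_const_nhds.congr fun x ↦ ?_⟩
  rw [wronskian, mul_comm, sub_self]

theorem isTruncTWValue_iff {d : ℝ} (hφ : wronskian (E.phi c s z) Ψ d ≠ 0) :
    E.IsTruncTWValue c s Ψ d z m ↔
      m = -wronskian (E.theta c s z) Ψ d / wronskian (E.phi c s z) Ψ d := by
  rw [IsTruncTWValue, psi, wronskian_add_smul_left, add_mul_eq_zero_iff hφ]

theorem HasRegularCoeffs.isTWValue_iff (hE : E.HasRegularCoeffs) (hz : E.IsLimitCircle z)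
    {A B : ℂ} (hA : Tendsto (wronskian (E.theta c s z) Ψ) E.toEnd (𝓝 A))
    (hB : Tendsto (wronskian (E.phi c s z) Ψ) E.toEnd (𝓝 B)) (hB₀ : B ≠ 0) :
    E.IsTWValue c s Ψ z m ↔ m = -A / B := by
  have := toEnd_neBot hE.a_lt_b
  have hlim : Tendsto (fun x ↦ wronskian (E.psi c s z m) Ψ x) E.toEnd (𝓝 (A + m * B)) := by
    simp only [psi, wronskian_add_smul_left]
    exact hA.add (hB.const_mul m)
  rw [← add_mul_eq_zero_iff hB₀]
  refine ⟨fun h ↦ tendsto_nhds_unique hlim h.2, fun h ↦ ⟨hz _ (hE.isSolution_psi c s z m), ?_⟩⟩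
  rwa [h] at hlim

theorem HasRegularCoeffs.tendsto_truncTWFunction (hE : E.HasRegularCoeffs)
    (hcs : c ≠ 0 ∨ s ≠ 0) (hz : E.IsLimitCircle z) (hΨ : E.IsSolution z' Ψ)
    (hΨ2 : E.MemL2w Ψ.1) (heig : ¬ E.IsEigenvalue c s Ψ z) {ι : Type*} {l : Filter ι} {d : ι → ℝ}
    (hd : Tendsto d l E.toEnd) :
    (∃! m, E.IsTWValue c s Ψ z m) ∧ (∀ᶠ i in l, ∃! m, E.IsTruncTWValue c s Ψ (d i) z m) ∧
      Tendsto (fun i ↦ E.truncTWFunction c s Ψ (d i) z) l (𝓝 (E.twFunction c s Ψ z)) := by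
  have hθ := hE.isSolution_theta c s z
  have hφ := hE.isSolution_phi c s z
  obtain ⟨A, hA⟩ := hE.exists_tendsto_wronskian hθ hΨ (hz _ hθ) hΨ2
  obtain ⟨B, hB⟩ := hE.exists_tendsto_wronskian hφ hΨ (hz _ hφ) hΨ2
  have hB₀ : B ≠ 0 := by
    rintro rfl
    exact heig (hE.isEigenvalue_of_bcAtEnd_phi hcs (hz _ hφ) hB)
  have htw : ∀ m, E.IsTWValue c s Ψ z m ↔ m = -A / B := fun m ↦ hE.isTWValue_iff hz hA hB hB₀
  have hev : ∀ᶠ i in l, wronskian (E.phi c s z) Ψ (d i) ≠ 0 := (hB.comp hd).eventually_ne hB₀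
  refine ⟨existsUnique_of_forall_iff htw,
    hev.mono fun i hi ↦ existsUnique_of_forall_iff fun m ↦ isTruncTWValue_iff hi, ?_⟩
  rw [twFunction, epsilon_eq_of_forall_iff htw]
  refine ((hA.comp hd).neg.div (hB.comp hd) hB₀).congr' ?_
  filter_upwards [hev] with i hi
  exact (epsilon_eq_of_forall_iff fun m ↦ isTruncTWValue_iff hi).symm

end TitchmarshWeyl

end SturmLiouville

theorem mainTheorem8_general {E : SturmLiouville} (hE : E.HasRegularCoeffs) {z₀ : ℂ}
    (hz₀ : E.IsLimitCircle z₀) {c s : ℂ} (hcs : c ^ 2 + s ^ 2 ≠ 0) (z' m' : ℂ)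
    {Ψ : (ℝ → ℂ) × (ℝ → ℂ)} (hΨ : Ψ = E.psi c s z' m')
    {ι : Type*} {l : Filter ι} {d : ι → ℝ} (hd : Tendsto d l E.toEnd) :
    (¬ E.IsEigenvalue c s Ψ z' ∧ E.twFunction c s Ψ z' = m') ∧
    (∀ (x : ℝ) (c₁ s₁ κ : ℂ), c₁ ≠ 0 ∨ s₁ ≠ 0 → c₁ = κ * Ψ.2 x → s₁ = κ * -Ψ.1 x →
      ∀ Y : (ℝ → ℂ) × (ℝ → ℂ),
        Y.1 x * c₁ + Y.2 x * s₁ = 0 ↔ SturmLiouville.wronskian Y Ψ x = 0) ∧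
    (∀ c₁ s₁ : ℂ, c₁ ≠ 0 ∨ s₁ ≠ 0 → ∀ z, ¬ E.IsEigenvalue c₁ s₁ Ψ z →
      (∃! m, E.IsTWValue c₁ s₁ Ψ z m) ∧ (∀ᶠ i in l, ∃! m, E.IsTruncTWValue c₁ s₁ Ψ (d i) z m) ∧
      Tendsto (fun i ↦ E.truncTWFunction c₁ s₁ Ψ (d i) z) l (𝓝 (E.twFunction c₁ s₁ Ψ z))) := by
  subst hΨ
  have hL2 := hz₀.of_isLimitCircle hE
  have hΨ := hE.isSolution_psi c s z' m'
  have heig := hE.not_isEigenvalue_psi hcs z' m'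
  have hunique := (hE.tendsto_truncTWFunction (ne_zero_or_ne_zero_of_sq_add_sq_ne_zero hcs)
    (hL2 z') hΨ (hL2 z' _ hΨ) heig hd).1
  have hm' := SturmLiouville.isTWValue_psi (hL2 z' _ hΨ)
  exact ⟨⟨heig, hunique.unique (Classical.epsilon_spec hunique.exists) hm'⟩,
    fun x c₁ s₁ κ h hc hs Y ↦ SturmLiouville.boundary_condition_iff_wronskian_eq_zero h hc hs,
    fun c₁ s₁ h z heig ↦ hE.tendsto_truncTWFunction h (hL2 z) hΨ (hL2 z' _ hΨ) heig hd⟩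

theorem mainTheorem8
    (E : SturmLiouville) (hE : E.IsStandard)
    (α : ℂ) (η : ℝ) (K : ℂ) (hS : (η, K) ∈ E.SOf α)
    (hcase : E.SimsCaseII η K ∨ E.SimsCaseIII η K)
    -- the boundary condition at `b` is `[y, Ψ](b) = 0` with `Ψ = θ(·, z') + m' φ(·, z')`
    (z' : ℂ) (hz' : z' ∈ SturmLiouville.Lam η K) (m' : ℂ)
    (Ψ : (ℝ → ℂ) × (ℝ → ℂ)) (hΨ : Ψ = E.psi (Complex.cos α) (Complex.sin α) z' m')
    -- the truncation points `bₙ ↗ b`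
    (bn : ℕ → ℝ) (hbn_mono : Monotone bn)
    (hbn_mem : ∀ n, E.a < bn n ∧ (bn n : EReal) < E.b)
    (hbn_lim : Filter.Tendsto (fun n => (bn n : EReal)) Filter.atTop (nhds E.b)) :
    -- `m'` is the value `m(z')`, and `z'` is not an eigenvalue of `M`
    (¬ E.IsEigenvalue (Complex.cos α) (Complex.sin α) Ψ z' ∧
      E.twFunction (Complex.cos α) (Complex.sin α) Ψ z' = m') ∧
    -- a condition with `(cos βₙ, sin βₙ) = const (pψ'(bₙ), -ψ(bₙ))` is `[y, Ψ](bₙ) = 0`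
    (∀ (n : ℕ) (β κ : ℂ), Complex.cos β = κ * Ψ.2 (bn n) → Complex.sin β = κ * (-Ψ.1 (bn n)) →
      ∀ Y : (ℝ → ℂ) × (ℝ → ℂ),
        Y.1 (bn n) * Complex.cos β + Y.2 (bn n) * Complex.sin β = 0 ↔
          SturmLiouville.wronskian Y Ψ (bn n) = 0) ∧
    -- `mₙ(z) → m(z)` at every `z` which is not an eigenvalue of `M`
    (∀ z : ℂ, ¬ E.IsEigenvalue (Complex.cos α) (Complex.sin α) Ψ z →
      (∃! m, E.IsTWValue (Complex.cos α) (Complex.sin α) Ψ z m) ∧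
      (∀ᶠ n in Filter.atTop,
        ∃! m, E.IsTruncTWValue (Complex.cos α) (Complex.sin α) Ψ (bn n) z m) ∧
      Filter.Tendsto
        (fun n => E.truncTWFunction (Complex.cos α) (Complex.sin α) Ψ (bn n) z) Filter.atTop
        (nhds (E.twFunction (Complex.cos α) (Complex.sin α) Ψ z))) ∧
    -- `ℓₙ(z) → ℓ(z)` at every `z` which is not an eigenvalue of `L`, the realization with
    -- `sin α y(a) - cos α py'(a) = 0` and the same condition at `b`
    (∀ z : ℂ, ¬ E.IsEigenvalue (Complex.sin α) (-Complex.cos α) Ψ z →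
      (∃! m, E.IsTWValue (Complex.sin α) (-Complex.cos α) Ψ z m) ∧
      (∀ᶠ n in Filter.atTop,
        ∃! m, E.IsTruncTWValue (Complex.sin α) (-Complex.cos α) Ψ (bn n) z m) ∧
      Filter.Tendsto
        (fun n => E.truncTWFunction (Complex.sin α) (-Complex.cos α) Ψ (bn n) z) Filter.atTop
        (nhds (E.twFunction (Complex.sin α) (-Complex.cos α) Ψ z))) := by
  have hpyth (β : ℂ) : Complex.cos β ^ 2 + Complex.sin β ^ 2 ≠ 0 :=
    Complex.cos_sq_add_sin_sq β ▸ one_ne_zero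
  have hne (β : ℂ) : Complex.cos β ≠ 0 ∨ Complex.sin β ≠ 0 :=
    ne_zero_or_ne_zero_of_sq_add_sq_ne_zero (hpyth β)
  obtain ⟨z₀, hz₀⟩ := SturmLiouville.exists_isLimitCircle_of_simsCase hcase
  obtain ⟨hm', hbc, hconv⟩ := mainTheorem8_general hE.hasRegularCoeffs hz₀ (hpyth α) z' m' hΨ
    (SturmLiouville.tendsto_toEnd (fun n ↦ (hbn_mem n).2) hbn_lim)
  exact ⟨hm', fun n β κ ↦ hbc (bn n) _ _ κ (hne β), hconv _ _ (hne α),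
    hconv _ _ ((hne α).symm.imp_right neg_ne_zero.2)⟩
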